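/- Let $S=\kappa[x_1,\dots,x_N]$ be a polynomial ring over a field $\kappa$ and let $I\subseteq S$ be a monomial ideal. Write $\operatorname{mingens}(I)$ for its minimal monomial generating set and $\gcd(I)$ for the greatest common divisor of the monomials in $I$ (when $I\ne 0$). For exponent vectors $\mathbf g\le\mathbf c$ in $\mathbb N^N$ let $C_{\mathbf g}(\mathbf c)$ be the set of all $\mathbf d\in\mathbb N^N$, $\mathbf d\neq 0$, such that $d_i\ge c_i$ for every $i$ with $c_i\neq g_i$, and $d_i<c_i$ for some $i$ with $c_i=g_i$. For a monomial $\mathbf n=x^{\mathbf c}\in I$ with $\gcd(I)=x^{\mathbf g}$ put $C_I(\mathbf n)=\{x^{\mathbf d} : \mathbf d\in C_{\mathbf g}(\mathbf c)\}$. Let $\Delta$ be a finite simplicial complex whose vertices are labelled by monomials of $S$, and label each face $\sigma$ by the least common multiple $\operatorname{lcm}(\sigma)$ of the labels of its vertices (so $\operatorname{lcm}(\emptyset)=1$). Fix a linear order of the vertices. The homogenized chain complex $\mathbb F_\Delta$ has in homological degree $i\ge 0$ the free $S$-module with basis $e_\sigma$, $\sigma\in\Delta\cup\{\emptyset\}$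 with $|\sigma|=i$, and differential $$d(e_\sigma)=\sum_{v\in\sigma}(-1)^{\#\{u\in\sigma\,:\,u<v\}}\,\frac{\operatorname{lcm}(\sigma)}{\operatorname{lcm}(\sigma\setminus\{v\})}\,e_{\sigma\setminus\{v\}}.$$ We say that $\Delta$ supports a free resolution of $I$ if $\mathbb F_\Delta$ is a free resolution of $S/I$, that is, it is exact in all positive degrees and the cokernel of $d_1$ is isomorphic to $S/I$. This resolution is minimal if the image of every differential lies in $(x_1,\dots,x_N)\mathbb F_\Delta$. **Theorem.** Let $\Delta$ support a free resolution of $I$. Let $\mathbf n$ and $\mathbf m$ be monomials with $\mathbf n\in\operatorname{mingens}(I)$, $\mathbf m\notin I$ and $\mathbf m\nmid\mathbf n$. Let $\Gamma$ be obtained from $\Delta$ by adding a new vertex labelled $\mathbf m$ and an edge that joins it to a vertex of $\Delta$ labelled $\mathbf n$. Then $\Gamma$ supports a free resolution of $I+(\mathbf m)$ if and only if $\mathbf m\in C_I(\mathbf n)$. Moreover, when $\mathbf m\in C_I(\mathbf n)$, the resolution of $I$ supported on $\Delta$ is minimal if and only if the resolution of $I+(\mathbf m)$ supported on $\Gamma$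 is minimal. -/

import Mathlib

open MvPolynomial

noncomputable section

/-! Monomials of `κ[x_1, …, x_N]` are written through their exponent vectors
`c : Fin N →₀ ℕ`: divisibility of monomials is `≤`, the lcm is `⊔`, and the monomial itself is
`monomial c 1`. -/

/-- The ideal generated by the monomials with exponent vector in `G`. -/
def monomialSpan (κ : Type*) [Field κ] {N : ℕ} (G : Set (Fin N →₀ ℕ)) :
    Ideal (MvPolynomial (Fin N) κ) :=
  Ideal.span ((fun c => monomial c (1 : κ)) '' G)

/-- A monomial ideal: an ideal that is generated by monomials. -/
def IsMonomialIdeal {κ : Type*} [Field κ] {N : ℕ} (I : Ideal (MvPolynomial (Fin N) κ)) : Prop :=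
  ∃ G : Set (Fin N →₀ ℕ), I = monomialSpan κ G

/-- The (exponent vectors of the) monomials that lie in `I`. -/
def monomialsIn {κ : Type*} [Field κ] {N : ℕ} (I : Ideal (MvPolynomial (Fin N) κ)) :
    Set (Fin N →₀ ℕ) :=
  {c | monomial c (1 : κ) ∈ I}

/-- The minimal monomial generators of `I`: the monomials of `I` that are minimal for
divisibility. By `isLeast_minGens` this is the smallest monomial generating set of `I`. -/
def minGens {κ : Type*} [Field κ] {N : ℕ} (I : Ideal (MvPolynomial (Fin N) κ)) :
    Set (Fin N →₀ ℕ) :=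
  {c | Minimal (fun d => d ∈ monomialsIn I) c}

theorem mem_monomialsIn_monomialSpan {κ : Type*} [Field κ] {N : ℕ} (G : Set (Fin N →₀ ℕ))
    (c : Fin N →₀ ℕ) : c ∈ monomialsIn (monomialSpan κ G) ↔ ∃ g ∈ G, g ≤ c := by
  classical
  unfold monomialsIn monomialSpan
  rw [Set.mem_ofPred_eq, mem_ideal_span_monomial_image]
  simp [support_monomial]

theorem isLeast_minGens {κ : Type*} [Field κ] {N : ℕ} (I : Ideal (MvPolynomial (Fin N) κ))
    (hI : IsMonomialIdeal I) :
    IsLeast {G : Set (Fin N →₀ ℕ) | I = monomialSpan κ G} (minGens I) := by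
  constructor
  · obtain ⟨G, rfl⟩ := hI
    apply le_antisymm
    · refine Ideal.span_le.2 ?_
      rintro _ ⟨c, hc, rfl⟩
      have hc' : c ∈ monomialsIn (monomialSpan κ G) := Ideal.subset_span ⟨c, hc, rfl⟩
      obtain ⟨b, hb, hmin⟩ := exists_minimal_le_of_wellFoundedLT
        (fun d => d ∈ monomialsIn (monomialSpan κ G)) c hc'
      exact (mem_monomialsIn_monomialSpan _ c).2 ⟨b, hmin, hb⟩
    · refine Ideal.span_le.2 ?_
      rintro _ ⟨c, hc, rfl⟩
      exact hc.1
  · rintro G rfl c hc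
    obtain ⟨g, hg, hgc⟩ := (mem_monomialsIn_monomialSpan G c).1 hc.1
    have hg' : g ∈ monomialsIn (monomialSpan κ G) := Ideal.subset_span ⟨g, hg, rfl⟩
    have := hc.2 hg' hgc
    rwa [le_antisymm this hgc]

/-- The exponent vector of `gcd(I)`, the greatest common divisor of the monomials in a nonzero
monomial ideal `I` (see `isGLB_gcdExp`). -/
def gcdExp {κ : Type*} [Field κ] {N : ℕ} (I : Ideal (MvPolynomial (Fin N) κ)) : Fin N →₀ ℕ :=
  Finsupp.equivFunOnFinite.symm fun i => sInf ((fun c : Fin N →₀ ℕ => c i) '' monomialsIn I)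

theorem isGLB_gcdExp {κ : Type*} [Field κ] {N : ℕ} (I : Ideal (MvPolynomial (Fin N) κ))
    (hI : (monomialsIn I).Nonempty) : IsGLB (monomialsIn I) (gcdExp I) := by
  constructor
  · intro c hc i
    exact Nat.sInf_le ⟨c, hc, rfl⟩
  · intro b hb i
    refine le_csInf (hI.image _) ?_
    rintro _ ⟨c, hc, rfl⟩
    exact hb hc i

/-- The set `C_g(c)`, used for `g ≤ c`. -/
def CSet {N : ℕ} (g c : Fin N →₀ ℕ) : Set (Fin N →₀ ℕ) :=
  {d | d ≠ 0 ∧ (∀ i ∈ (c - g).support, c i ≤ d i) ∧ ∃ i, i ∉ (c - g).support ∧ d i < c i}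

/-- The set `C_I(n) = C_{gcd(I)}(n)`. -/
def CIdeal {κ : Type*} [Field κ] {N : ℕ} (I : Ideal (MvPolynomial (Fin N) κ))
    (n : Fin N →₀ ℕ) : Set (Fin N →₀ ℕ) :=
  CSet (gcdExp I) n

/-- The sequence `⋯ ⟶ F 2 ⟶ F 1 ⟶ F 0 ⟶ 0`, with `d i : F (i + 1) ⟶ F i`, is a (finite) free
resolution of `M`: finitely generated free modules, zero from some degree on, exact in all positive
degrees, with cokernel of `d 0` isomorphic to `M`. -/
structure IsFreeResolution {R : Type*} [CommRing R] (F : ℕ → Type*) [∀ i, AddCommGroup (F i)]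
    [∀ i, Module R (F i)] (d : ∀ i, F (i + 1) →ₗ[R] F i)
    (M : Type*) [AddCommGroup M] [Module R M] : Prop where
  free : ∀ i, Module.Free R (F i)
  finite : ∀ i, Module.Finite R (F i)
  bounded : ∃ p, ∀ i, p < i → Subsingleton (F i)
  exact : ∀ i, Function.Exact (d (i + 1)) (d i)
  coker : Nonempty ((F 0 ⧸ LinearMap.range (d 0)) ≃ₗ[R] M)

/-- The nonempty faces are the faces of `Δ`; the empty set is always counted as a face.
`FaceOfCard Δ i` is the type of faces with exactly `i` vertices. -/
abbrev FaceOfCard {V : Type*} (Δ : PreAbstractSimplicialComplex V) (i : ℕ) : Type _ :=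
  {σ : Finset V // (σ = ∅ ∨ σ ∈ Δ) ∧ σ.card = i}

/-- The face `σ \ {v}`. -/
def FaceOfCard.erase {V : Type*} [DecidableEq V] {Δ : PreAbstractSimplicialComplex V} {i : ℕ}
    (σ : FaceOfCard Δ (i + 1)) (v : V) (hv : v ∈ σ.1) : FaceOfCard Δ i :=
  ⟨σ.1.erase v, by
    obtain ⟨σ, hσ, hc⟩ := σ
    refine ⟨?_, by rw [Finset.card_erase_of_mem hv, hc, Nat.add_sub_cancel]⟩
    rcases Finset.eq_empty_or_nonempty (σ.erase v) with h | h
    · exact Or.inl h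
    · rcases hσ with rfl | hσ
      · simp at hv
      · exact Or.inr ((Δ.isRelLowerSet_faces hσ).2 (Finset.erase_subset v σ) h)⟩

/-- The label of a face: the lcm of the labels of its vertices. -/
def faceLabel {V : Type*} {N : ℕ} (ℓ : V → Fin N →₀ ℕ) (σ : Finset V) : Fin N →₀ ℕ :=
  σ.sup ℓ

/-- The free module in homological degree `i` of the homogenized chain complex of `Δ`, with one
basis element for each face with `i` vertices. -/
abbrev HomogenizedModule (κ : Type*) [Field κ] (N : ℕ) {V : Type*}
    (Δ : PreAbstractSimplicialComplex V) (i : ℕ) : Type _ :=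
  FaceOfCard Δ i →₀ MvPolynomial (Fin N) κ

/-- The differential of the homogenized chain complex: the basis element of `σ` goes to
`∑_{v ∈ σ} ± (label σ / label (σ \ {v})) • (basis element of σ \ {v})`, where the sign is `-1` to the
number of vertices of `σ` before `v`, as in the augmented oriented simplicial chain complex. The
linear order on the vertices only serves to fix the orientations. -/
def homogenizedDiff (κ : Type*) [Field κ] {N : ℕ} {V : Type*} [LinearOrder V]
    (Δ : PreAbstractSimplicialComplex V) (ℓ : V → Fin N →₀ ℕ) (i : ℕ) :
    HomogenizedModule κ N Δ (i + 1) →ₗ[MvPolynomial (Fin N) κ] HomogenizedModule κ N Δ i :=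
  Finsupp.linearCombination (MvPolynomial (Fin N) κ) fun σ : FaceOfCard Δ (i + 1) =>
    ∑ v ∈ σ.1.attach, Finsupp.single (σ.erase v.1 v.2)
      (monomial (faceLabel ℓ σ.1 - faceLabel ℓ (σ.1.erase v.1))
        ((-1 : κ) ^ (σ.1.filter (fun u => u < v.1)).card))

/-- `Δ`, with its vertices labelled by monomials through `ℓ`, supports a free resolution of `S/I`
(one says: of `I`). The labels of the vertices then generate `I`, since the cokernel of the first
differential is the quotient of `S` by the ideal generated by these labels. -/
def SupportsFreeResolution {κ : Type*} [Field κ] {N : ℕ} {V : Type*} [LinearOrder V]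
    (Δ : PreAbstractSimplicialComplex V) (ℓ : V → Fin N →₀ ℕ)
    (I : Ideal (MvPolynomial (Fin N) κ)) : Prop :=
  IsFreeResolution (HomogenizedModule κ N Δ) (homogenizedDiff κ Δ ℓ) (MvPolynomial (Fin N) κ ⧸ I)

/-- The homogenized chain complex of `Δ` is a minimal free resolution of `S/I`: it is a free
resolution and every differential has its image in `(x_1, …, x_N) F`. -/
def SupportsMinimalFreeResolution {κ : Type*} [Field κ] {N : ℕ} {V : Type*} [LinearOrder V]
    (Δ : PreAbstractSimplicialComplex V) (ℓ : V → Fin N →₀ ℕ)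
    (I : Ideal (MvPolynomial (Fin N) κ)) : Prop :=
  SupportsFreeResolution Δ ℓ I ∧
    ∀ i, LinearMap.range (homogenizedDiff κ Δ ℓ i) ≤
      Ideal.span (Set.range (X : Fin N → MvPolynomial (Fin N) κ)) •
        (⊤ : Submodule (MvPolynomial (Fin N) κ) (HomogenizedModule κ N Δ i))

/-- `Δ ∪ {{w}, {w, v}}`: the complex `Δ` with the vertex `w` and the edge `{w, v}` added, where `v`
is a vertex of `Δ`. -/
def addEdge {V : Type*} [DecidableEq V] (Δ : PreAbstractSimplicialComplex V) (v w : V)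
    (hv : {v} ∈ Δ) : PreAbstractSimplicialComplex V where
  faces := Δ.faces ∪ {{w}, {w, v}}
  isRelLowerSet_faces := by
    rintro σ (hσ | rfl | rfl)
    · exact ⟨(Δ.isRelLowerSet_faces hσ).1, fun τ h1 h2 =>
        Or.inl ((Δ.isRelLowerSet_faces hσ).2 h1 h2)⟩
    · refine ⟨Finset.singleton_nonempty w, fun τ h1 h2 => ?_⟩
      rcases Finset.subset_singleton_iff.1 h1 with rfl | rfl
      · exact absurd rfl h2.ne_empty
      · exact Or.inr (Or.inl rfl)
    · refine ⟨Finset.insert_nonempty _ _, fun τ h1 h2 => ?_⟩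
      by_cases hw : w ∈ τ <;> by_cases hv' : v ∈ τ
      · refine Or.inr (Or.inr (Finset.Subset.antisymm h1 ?_))
        exact Finset.insert_subset hw (Finset.singleton_subset_iff.2 hv')
      · refine Or.inr (Or.inl (Finset.Subset.antisymm ?_ (Finset.singleton_subset_iff.2 hw)))
        intro x hx
        have := h1 hx
        simp only [Finset.mem_insert, Finset.mem_singleton] at this ⊢
        rcases this with h | rfl
        · exact h
        · exact absurd hx hv'
      · have : τ = {v} := by
          refine Finset.Subset.antisymm ?_ (Finset.singleton_subset_iff.2 hv')
          intro x hx
          have := h1 hx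
          simp only [Finset.mem_insert, Finset.mem_singleton] at this ⊢
          rcases this with rfl | h
          · exact absurd hx hw
          · exact h
        exact Or.inl (this ▸ hv)
      · obtain ⟨x, hx⟩ := h2
        have := h1 hx
        simp only [Finset.mem_insert, Finset.mem_singleton] at this
        rcases this with rfl | rfl
        · exact absurd hx hw
        · exact absurd hx hv'

end

noncomputable section

/-! ### The set `C_I(n)` and the colon ideal `(I : m)`. -/

variable {κ : Type*} [Field κ] {N : ℕ}

/-! Write `F_Δ`, `F_Γ` for the two complexes. `F_Δ` is a subcomplex of `F_Γ`, and the quotient is `S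
→ S` in degrees 2 and 1, spanned by the new edge and the new vertex, with map multiplication by `±
lcm(n, m) / m`. This map is injective with cokernel `S / (lcm(n, m) / m)`. The connecting map to
`H_0(F_Δ) = S/I` is multiplication by `m`, so `H_1(F_Γ) = (I : m) / (lcm(n, m) / m)`; the higher
homology vanishes and the cokernel of `d_1` is always `S/(I + (m))`. Hence `Γ` supports a resolution
exactly when `(I : m)` is generated by `lcm(n, m) / m`. The proof carries this out on elements, in
`monomial_dvd_of_exact_addEdge`, `exact_addEdge` and `coker_addEdge`.

The colon ideal is generated by the `lcm(c, m) / m` with `c` a monomial of `I`, so the condition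
says that `n` divides every `lcm(c, m)`. Coordinatewise this means that `n` divides `lcm(gcd(I),
m)`, which is membership in `C_I(n)` because `n ∤ m` and `m ≠ 1` (`mem_CSet_iff`,
`mem_CIdeal_iff_colon`).

For minimality, the old matrix entries are unchanged and the new ones are, up to sign, `m`, `lcm(n,
m) / m` and `lcm(n, m) / n`. None is a unit, since `m ≠ 1` and neither of `n`, `m` divides the
other. -/

theorem mem_monomialsIn_of_mem_support {I : Ideal (MvPolynomial (Fin N) κ)}
    (hI : IsMonomialIdeal I) {p : MvPolynomial (Fin N) κ} (hp : p ∈ I) {u : Fin N →₀ ℕ}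
    (hu : u ∈ p.support) : u ∈ monomialsIn I := by
  obtain ⟨G, rfl⟩ := hI
  rw [mem_monomialsIn_monomialSpan]
  exact mem_ideal_span_monomial_image.1 hp u hu

/-- At a coordinate where `c` and `g` agree, the inequality `c ≤ g ⊔ d` is automatic, so only the
support of `c - g` constrains `d`. Once `c ≤ d` on that support, any witness of `¬ c ≤ d` lies
outside it and gives the last clause of `CSet`. -/
theorem mem_CSet_iff {g c d : Fin N →₀ ℕ} (hd : d ≠ 0) (hcd : ¬ c ≤ d) :
    d ∈ CSet g c ↔ c ≤ g ⊔ d := by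
  have key : c ≤ g ⊔ d ↔ ∀ i ∈ (c - g).support, c i ≤ d i := by
    refine forall_congr' fun i => ?_
    simp only [Finsupp.sup_apply, Finsupp.mem_support_iff, Finsupp.tsub_apply, le_sup_iff]
    omega
  rw [key]
  refine ⟨fun h => h.2.1, fun h => ⟨hd, h, ?_⟩⟩
  obtain ⟨i, hi⟩ : ∃ i, ¬ c i ≤ d i := by simpa [Finsupp.le_def] using hcd
  exact ⟨i, fun hs => hi (h i hs), not_le.1 hi⟩

theorem monomial_one_dvd_iff {c : Fin N →₀ ℕ} {p : MvPolynomial (Fin N) κ} :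
    monomial c (1 : κ) ∣ p ↔ ∀ u ∈ p.support, c ≤ u := by
  rw [← Ideal.mem_span_singleton]
  simpa using mem_ideal_span_monomial_image (R := κ) (x := p) (s := {c})

/-- The colon ideal `(I : m)` is generated by `lcm(n, m) / m` exactly when `m ∈ C_I(n)`. -/
theorem mem_CIdeal_iff_colon {I : Ideal (MvPolynomial (Fin N) κ)} (hI : IsMonomialIdeal I)
    {n m : Fin N →₀ ℕ} (hn : n ∈ monomialsIn I) (hm : m ∉ monomialsIn I) (hm0 : m ≠ 0) :
    m ∈ CIdeal I n ↔ ∀ s : MvPolynomial (Fin N) κ,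
      s * monomial m 1 ∈ I → monomial (n ⊔ m - m) 1 ∣ s := by
  have hglb := isGLB_gcdExp I ⟨n, hn⟩
  have hup : ∀ {c d}, c ∈ monomialsIn I → c ≤ d → d ∈ monomialsIn I := by
    intro c d hc hcd
    have := I.mul_mem_left (monomial (d - c) (1 : κ)) hc
    rwa [monomial_mul, mul_one, tsub_add_cancel_of_le hcd] at this
  have hnm : ¬ n ≤ m := fun h => hm (hup hn h)
  rw [CIdeal, mem_CSet_iff hm0 hnm]
  constructor
  · intro h s hs
    refine monomial_one_dvd_iff.2 fun u hu => ?_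
    have hum : u + m ∈ (s * monomial m (1 : κ)).support := by
      rw [mem_support_iff, coeff_mul_monomial, mul_one]
      exact mem_support_iff.1 hu
    have hg := hglb.1 (mem_monomialsIn_of_mem_support hI hs hum)
    exact tsub_le_iff_right.2
      (sup_le (h.trans (sup_le hg le_add_self)) le_add_self)
  · intro h
    have hc : ∀ c ∈ monomialsIn I, n ≤ c ⊔ m := by
      intro c hc
      -- Test the divisibility on the generator `lcm(c, m) / m` of the colon ideal.
      have hs := h (monomial (c ⊔ m - m) 1) (by
        rw [monomial_mul, mul_one, tsub_add_cancel_of_le le_sup_right]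
        exact hup hc le_sup_left)
      have := monomial_one_dvd_iff.1 hs (c ⊔ m - m) (by simp [mem_support_iff])
      rw [tsub_le_iff_right, tsub_add_cancel_of_le le_sup_right] at this
      exact le_sup_left.trans this
    -- If `n i` exceeded both `gcdExp I i` and `m i`, every monomial of `I` would have `i`-th
    -- exponent at least `n i`, and the gcd could be enlarged at `i`.
    intro i
    by_contra hi
    simp only [Finsupp.sup_apply, le_sup_iff, not_or, not_le] at hi
    have : (gcdExp I) ⊔ Finsupp.single i (n i) ≤ gcdExp I := by
      refine hglb.2 fun c hcI => sup_le (hglb.1 hcI) (Finsupp.single_le_iff.2 ?_)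
      have := hc c hcI i
      simp only [Finsupp.sup_apply, le_sup_iff] at this
      omega
    have := this i
    simp only [Finsupp.sup_apply, Finsupp.single_eq_same, sup_le_iff] at this
    omega

/-! ### Subcomplexes and the differential in low degrees. -/

section Inclusion

variable {V : Type*} {Δ Γ : PreAbstractSimplicialComplex V}

/-- A face of a subcomplex, as a face of the complex. -/
def FaceOfCard.inclusion (h : Δ ≤ Γ) {i : ℕ} (σ : FaceOfCard Δ i) : FaceOfCard Γ i :=
  ⟨σ.1, σ.2.1.imp id fun hσ => h hσ, σ.2.2⟩

theorem FaceOfCard.inclusion_injective (h : Δ ≤ Γ) (i : ℕ) :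
    Function.Injective (FaceOfCard.inclusion h (i := i)) := fun _ _ hst =>
  Subtype.ext (congrArg (fun σ : FaceOfCard Γ i => σ.1) hst)

theorem FaceOfCard.mem_range_inclusion (h : Δ ≤ Γ) {i : ℕ} (σ : FaceOfCard Γ i)
    (hσ : σ.1 = ∅ ∨ σ.1 ∈ Δ) : σ ∈ Set.range (FaceOfCard.inclusion h (i := i)) :=
  ⟨⟨σ.1, hσ, σ.2.2⟩, rfl⟩

variable (κ N) in
/-- The inclusion of homogenized chain modules induced by a subcomplex. -/
def inclusionMap (h : Δ ≤ Γ) (i : ℕ) :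
    HomogenizedModule κ N Δ i →ₗ[MvPolynomial (Fin N) κ] HomogenizedModule κ N Γ i :=
  Finsupp.lmapDomain _ _ (FaceOfCard.inclusion h)

theorem inclusionMap_single (h : Δ ≤ Γ) (i : ℕ) (σ : FaceOfCard Δ i)
    (p : MvPolynomial (Fin N) κ) :
    inclusionMap κ N h i (Finsupp.single σ p) = Finsupp.single (σ.inclusion h) p :=
  Finsupp.mapDomain_single

theorem inclusionMap_injective (h : Δ ≤ Γ) (i : ℕ) :
    Function.Injective (inclusionMap κ N h i) :=
  Finsupp.mapDomain_injective (FaceOfCard.inclusion_injective h i)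

theorem inclusionMap_apply_of_notMem (h : Δ ≤ Γ) (i : ℕ) (a : HomogenizedModule κ N Δ i)
    (τ : FaceOfCard Γ i) (hτ : ¬ (τ.1 = ∅ ∨ τ.1 ∈ Δ)) : inclusionMap κ N h i a τ = 0 := by
  refine Finsupp.mapDomain_of_notMem_range _ _ ?_
  rintro ⟨σ, rfl⟩
  exact hτ σ.2.1

/-- The retraction forgets the faces outside `Δ`. Being linear, it carries membership in `J • ⊤`
back from `Γ` to `Δ`. -/
theorem exists_leftInverse_inclusionMap (h : Δ ≤ Γ) (i : ℕ) :
    ∃ r : HomogenizedModule κ N Γ i →ₗ[MvPolynomial (Fin N) κ] HomogenizedModule κ N Δ i,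
      ∀ a, r (inclusionMap κ N h i a) = a :=
  ⟨Finsupp.lcomapDomain _ (FaceOfCard.inclusion_injective h i), fun a =>
    Finsupp.comapDomain_mapDomain _ (FaceOfCard.inclusion_injective h i) a⟩

theorem inclusionMap_surjective (h : Δ ≤ Γ) (i : ℕ)
    (hi : ∀ σ : FaceOfCard Γ i, σ.1 = ∅ ∨ σ.1 ∈ Δ) :
    Function.Surjective (inclusionMap κ N h i) :=
  Finsupp.mapDomain_surjective fun σ => FaceOfCard.mem_range_inclusion h σ (hi σ)

theorem exists_inclusionMap_add_single (h : Δ ≤ Γ) (i : ℕ) (τ : FaceOfCard Γ i)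
    (hi : ∀ σ : FaceOfCard Γ i, (σ.1 = ∅ ∨ σ.1 ∈ Δ) ∨ σ = τ)
    (a : HomogenizedModule κ N Γ i) :
    ∃ b s, a = inclusionMap κ N h i b + Finsupp.single τ s := by
  induction a using Finsupp.induction_linear with
  | zero => exact ⟨0, 0, by simp⟩
  | add f g hf hg =>
    obtain ⟨b, s, rfl⟩ := hf
    obtain ⟨c, t, rfl⟩ := hg
    exact ⟨b + c, s + t, by rw [map_add, Finsupp.single_add]; abel⟩
  | single σ p =>
    rcases hi σ with hσ | rfl
    · obtain ⟨σ, rfl⟩ := FaceOfCard.mem_range_inclusion h σ hσ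
      exact ⟨Finsupp.single σ p, 0, by simp [inclusionMap_single]⟩
    · exact ⟨0, p, by simp⟩

variable [LinearOrder V] (ℓ : V → Fin N →₀ ℕ)

theorem homogenizedDiff_single (i : ℕ) (σ : FaceOfCard Δ (i + 1)) (p : MvPolynomial (Fin N) κ) :
    homogenizedDiff κ Δ ℓ i (Finsupp.single σ p) =
      p • ∑ v ∈ σ.1.attach, Finsupp.single (σ.erase v.1 v.2)
        (monomial (faceLabel ℓ σ.1 - faceLabel ℓ (σ.1.erase v.1))
          ((-1 : κ) ^ (σ.1.filter (fun u => u < v.1)).card)) :=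
  Finsupp.linearCombination_single _ _ _

theorem homogenizedDiff_inclusionMap (h : Δ ≤ Γ) (i : ℕ) (a : HomogenizedModule κ N Δ (i + 1)) :
    homogenizedDiff κ Γ ℓ i (inclusionMap κ N h (i + 1) a) =
      inclusionMap κ N h i (homogenizedDiff κ Δ ℓ i a) := by
  induction a using Finsupp.induction_linear with
  | zero => simp
  | add f g hf hg => simp only [map_add, hf, hg]
  | single σ p =>
    rw [inclusionMap_single, homogenizedDiff_single, homogenizedDiff_single, map_smul, map_sum]
    simp only [inclusionMap_single]
    rfl

/-- The empty face. -/
def emptyFace (Δ : PreAbstractSimplicialComplex V) : FaceOfCard Δ 0 :=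
  ⟨∅, Or.inl rfl, Finset.card_empty⟩

instance (Δ : PreAbstractSimplicialComplex V) : Unique (FaceOfCard Δ 0) where
  default := emptyFace Δ
  uniq σ := Subtype.ext (Finset.card_eq_zero.1 σ.2.2)

/-- A vertex, as a face. -/
def vertexFace (x : V) (hx : {x} ∈ Δ) : FaceOfCard Δ 1 :=
  ⟨{x}, Or.inr hx, Finset.card_singleton x⟩

/-- An edge, as a face. -/
def edgeFace (x y : V) (hxy : x ≠ y) (h : {x, y} ∈ Δ) : FaceOfCard Δ 2 :=
  ⟨{x, y}, Or.inr h, Finset.card_pair hxy⟩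

theorem homogenizedDiff_vertexFace (x : V) (hx : {x} ∈ Δ) (p : MvPolynomial (Fin N) κ) :
    homogenizedDiff κ Δ ℓ 0 (Finsupp.single (vertexFace x hx) p) =
      Finsupp.single (emptyFace Δ) (p * monomial (ℓ x) 1) := by
  rw [homogenizedDiff_single]
  have h : (vertexFace x hx).1.attach = {⟨x, Finset.mem_singleton_self x⟩} := by
    ext ⟨y, hy⟩
    have : y = x := Finset.mem_singleton.1 hy
    simp [this]
  rw [h, Finset.sum_singleton, Finsupp.smul_single, smul_eq_mul]
  congr 1
  · exact Subsingleton.elim _ _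
  · simp [vertexFace, faceLabel, Finset.filter_singleton, bot_eq_zero]

/-- The two signs in the boundary of an edge are opposite whatever the order of its endpoints, so
one `ε = ±1` serves both cases. -/
theorem homogenizedDiff_edgeFace (x y : V) (hxy : x ≠ y) (h : {x, y} ∈ Δ) (hx : {x} ∈ Δ)
    (hy : {y} ∈ Δ) : ∃ ε : κ, ε ^ 2 = 1 ∧ ∀ p : MvPolynomial (Fin N) κ,
      homogenizedDiff κ Δ ℓ 1 (Finsupp.single (edgeFace x y hxy h) p) =
        Finsupp.single (vertexFace x hx) (C ε * (p * monomial (ℓ y ⊔ ℓ x - ℓ x) 1)) -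
        Finsupp.single (vertexFace y hy) (C ε * (p * monomial (ℓ y ⊔ ℓ x - ℓ y) 1)) := by
  have hatt : (edgeFace x y hxy h).1.attach =
      {⟨x, Finset.mem_insert_self _ _⟩,
        ⟨y, Finset.mem_insert_of_mem (Finset.mem_singleton_self _)⟩} := by
    ext ⟨z, hz⟩
    have : z = x ∨ z = y := by simpa [edgeFace] using hz
    refine iff_of_true (Finset.mem_attach _ _) ?_
    rw [Finset.mem_insert, Finset.mem_singleton]
    exact this.imp Subtype.ext Subtype.ext
  have hex : ({x, y} : Finset V).erase x = {y} := by
    ext z; simp; grind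
  have hey : ({x, y} : Finset V).erase y = {x} := by
    ext z; simp; grind
  have hfx : (edgeFace x y hxy h).erase x (Finset.mem_insert_self _ _) = vertexFace y hy :=
    Subtype.ext hex
  have hfy : (edgeFace x y hxy h).erase y
      (Finset.mem_insert_of_mem (Finset.mem_singleton_self _)) = vertexFace x hx :=
    Subtype.ext hey
  have hL : faceLabel ℓ ({x, y} : Finset V) = ℓ y ⊔ ℓ x := by
    simp [faceLabel, Finset.sup_insert, sup_comm]
  have hmon : ∀ (p : MvPolynomial (Fin N) κ) (c : Fin N →₀ ℕ) (e : κ),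
      p * monomial c e = C e * (p * monomial c 1) := by
    intro p c e
    rw [mul_left_comm, C_mul_monomial, mul_one]
  have hsum : ∀ p : MvPolynomial (Fin N) κ,
      homogenizedDiff κ Δ ℓ 1 (Finsupp.single (edgeFace x y hxy h) p) =
        Finsupp.single (vertexFace y hy) (p * monomial (ℓ y ⊔ ℓ x - ℓ y)
          ((-1) ^ (({x, y} : Finset V).filter (fun u => u < x)).card)) +
        Finsupp.single (vertexFace x hx) (p * monomial (ℓ y ⊔ ℓ x - ℓ x)
          ((-1) ^ (({x, y} : Finset V).filter (fun u => u < y)).card)) := by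
    intro p
    rw [homogenizedDiff_single, hatt, Finset.sum_pair (fun he => hxy (congrArg Subtype.val he)), smul_add,
      Finsupp.smul_single, Finsupp.smul_single, hfx, hfy]
    simp only [edgeFace, hex, hey, hL, smul_eq_mul]
    simp [faceLabel]
  rcases lt_or_gt_of_ne hxy with hlt | hlt
  · refine ⟨-1, by norm_num, fun p => ?_⟩
    have h1 : ({x, y} : Finset V).filter (fun u => u < x) = ∅ := by
      ext z; simp; grind
    have h2 : ({x, y} : Finset V).filter (fun u => u < y) = {x} := by
      ext z; simp; grind
    rw [hsum, h1, h2, hmon p _ ((-1) ^ _), hmon p _ ((-1) ^ _)]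
    simp [add_comm]
  · refine ⟨1, by norm_num, fun p => ?_⟩
    have h1 : ({x, y} : Finset V).filter (fun u => u < x) = {y} := by
      ext z; simp; grind
    have h2 : ({x, y} : Finset V).filter (fun u => u < y) = ∅ := by
      ext z; simp; grind
    rw [hsum, h1, h2, hmon p _ ((-1) ^ _), hmon p _ ((-1) ^ _)]
    simp [sub_eq_add_neg, add_comm]

/-- The cokernel of `d 0` is isomorphic to `S/I` if and only if the image of `d 0` is `I`. -/
theorem nonempty_coker_equiv_iff (I : Ideal (MvPolynomial (Fin N) κ)) :
    Nonempty ((HomogenizedModule κ N Δ 0 ⧸ LinearMap.range (homogenizedDiff κ Δ ℓ 0))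
        ≃ₗ[MvPolynomial (Fin N) κ] (MvPolynomial (Fin N) κ ⧸ I)) ↔
      ∀ p, Finsupp.single (emptyFace Δ) p ∈ LinearMap.range (homogenizedDiff κ Δ ℓ 0) ↔
        p ∈ I := by
  constructor
  · rintro ⟨e⟩ p
    -- An abstract isomorphism need not respect `F 0 ≃ S`, but the annihilator is an invariant: it
    -- is `I` on one side and the image of `d 0` on the other.
    have hann := e.annihilator_eq
    rw [Ideal.annihilator_quotient] at hann
    rw [← hann, Module.mem_annihilator]
    constructor
    · intro hp y
      obtain ⟨y, rfl⟩ := Submodule.Quotient.mk_surjective _ y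
      rw [← Submodule.Quotient.mk_smul, Submodule.Quotient.mk_eq_zero]
      have : p • y = (y default) • Finsupp.single (emptyFace Δ) p := by
        rw [Finsupp.unique_single y]
        simp only [Finsupp.smul_single, smul_eq_mul, Finsupp.single_eq_same, mul_comm]
        rfl
      rw [this]
      exact Submodule.smul_mem _ _ hp
    · intro hp
      have := hp (Submodule.Quotient.mk (Finsupp.single (emptyFace Δ) 1))
      rwa [← Submodule.Quotient.mk_smul, Submodule.Quotient.mk_eq_zero, Finsupp.smul_single,
        smul_eq_mul, mul_one] at this
  · intro h
    refine ⟨Submodule.Quotient.equiv _ _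
      (Finsupp.uniqueLinearEquiv (MvPolynomial (Fin N) κ) (MvPolynomial (Fin N) κ)
        (emptyFace Δ)) ?_⟩
    ext p
    rw [Submodule.mem_map_equiv, ← h p]
    rfl

end Inclusion

end

noncomputable section

/-! ### Elements of `J • ⊤`. -/

section Minimality

variable {R : Type*} [CommRing R]

theorem LinearMap.map_mem_smul_top {M M' : Type*} [AddCommGroup M] [Module R M]
    [AddCommGroup M'] [Module R M'] (f : M →ₗ[R] M') {J : Ideal R} {x : M}
    (hx : x ∈ J • (⊤ : Submodule R M)) : f x ∈ J • (⊤ : Submodule R M') := by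
  have := Submodule.mem_map_of_mem (f := f) hx
  rw [Submodule.map_smul''] at this
  exact Submodule.smul_mono le_rfl le_top this

theorem Finsupp.single_mem_smul_top {α : Type*} {J : Ideal R} (a : α) {p : R} (hp : p ∈ J) :
    Finsupp.single a p ∈ J • (⊤ : Submodule R (α →₀ R)) := by
  have := Submodule.smul_mem_smul hp (Submodule.mem_top (R := R) (x := Finsupp.single a (1 : R)))
  rwa [Finsupp.smul_single, smul_eq_mul, mul_one] at this

end Minimality

variable {κ : Type*} [Field κ] {N : ℕ}

theorem monomial_mem_span_X {c : Fin N →₀ ℕ} (hc : c ≠ 0) (e : κ) :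
    monomial c e ∈ Ideal.span (Set.range (X : Fin N → MvPolynomial (Fin N) κ)) := by
  obtain ⟨i, hi⟩ := Finsupp.ne_iff.1 hc
  exact Ideal.mem_of_dvd _ (X_dvd_monomial.2 (Or.inr hi)) (Ideal.subset_span ⟨i, rfl⟩)

/-! ### Adding the edge: cokernel, exactness and minimality. -/

section AddEdge

variable {V : Type*} [LinearOrder V] {Δ : PreAbstractSimplicialComplex V} {v w : V}

theorem le_addEdge (hv : {v} ∈ Δ) : Δ ≤ addEdge Δ v w hv := fun _ hσ => Or.inl hσ

theorem singleton_mem_addEdge (hv : {v} ∈ Δ) : {w} ∈ addEdge Δ v w hv := Or.inr (Or.inl rfl)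

theorem pair_mem_addEdge (hv : {v} ∈ Δ) : {w, v} ∈ addEdge Δ v w hv := Or.inr (Or.inr rfl)

omit [LinearOrder V] in
theorem ne_of_singleton_notMem (hv : {v} ∈ Δ) (hw : {w} ∉ Δ) : w ≠ v := by
  rintro rfl; exact hw hv

theorem FaceOfCard.addEdge_cases (hv : {v} ∈ Δ) {i : ℕ} (σ : FaceOfCard (addEdge Δ v w hv) i) :
    (σ.1 = ∅ ∨ σ.1 ∈ Δ) ∨ σ.1 = {w} ∨ σ.1 = {w, v} := by
  rcases σ.2.1 with h | h | h
  · exact Or.inl (Or.inl h)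
  · exact Or.inl (Or.inr h)
  · exact Or.inr h

variable (κ N) in
theorem inclusionMap_addEdge_zero_surjective (hv : {v} ∈ Δ) :
    Function.Surjective (inclusionMap κ N (le_addEdge (w := w) hv) 0) :=
  inclusionMap_surjective _ _ fun σ => Or.inl (Finset.card_eq_zero.1 σ.2.2)

variable (κ N) in
theorem inclusionMap_addEdge_surjective (hv : {v} ∈ Δ) {i : ℕ} (hi : 3 ≤ i) :
    Function.Surjective (inclusionMap κ N (le_addEdge (w := w) hv) i) := by
  refine inclusionMap_surjective _ _ fun σ => ?_
  rcases σ.addEdge_cases hv with h | h | h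
  · exact h
  · have := σ.2.2
    rw [h, Finset.card_singleton] at this
    omega
  · have := σ.2.2 ▸ h ▸ Finset.card_le_two (a := w) (b := v)
    omega

theorem exists_inclusionMap_add_vertex (hv : {v} ∈ Δ) (hw : {w} ∉ Δ)
    (a : HomogenizedModule κ N (addEdge Δ v w hv) 1) :
    ∃ b s, a = inclusionMap κ N (le_addEdge hv) 1 b +
      Finsupp.single (vertexFace w (singleton_mem_addEdge hv)) s := by
  refine exists_inclusionMap_add_single _ _ _ (fun σ => ?_) a
  rcases σ.addEdge_cases hv with h | h | h
  · exact Or.inl h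
  · exact Or.inr (Subtype.ext h)
  · have := σ.2.2
    rw [h, Finset.card_pair (ne_of_singleton_notMem hv hw)] at this
    omega

theorem exists_inclusionMap_add_edge (hv : {v} ∈ Δ) (hw : {w} ∉ Δ)
    (a : HomogenizedModule κ N (addEdge Δ v w hv) 2) :
    ∃ b s, a = inclusionMap κ N (le_addEdge hv) 2 b +
      Finsupp.single (edgeFace w v (ne_of_singleton_notMem hv hw) (pair_mem_addEdge hv)) s := by
  refine exists_inclusionMap_add_single _ _ _ (fun σ => ?_) a
  rcases σ.addEdge_cases hv with h | h | h
  · exact Or.inl h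
  · have := σ.2.2
    rw [h, Finset.card_singleton] at this
    omega
  · exact Or.inr (Subtype.ext h)

variable (ℓ : V → Fin N →₀ ℕ)

theorem coker_addEdge {I : Ideal (MvPolynomial (Fin N) κ)} (hv : {v} ∈ Δ) (hw : {w} ∉ Δ)
    (hI : ∀ p, Finsupp.single (emptyFace Δ) p ∈ LinearMap.range (homogenizedDiff κ Δ ℓ 0) ↔
      p ∈ I) (p : MvPolynomial (Fin N) κ) :
    Finsupp.single (emptyFace (addEdge Δ v w hv)) p ∈
        LinearMap.range (homogenizedDiff κ (addEdge Δ v w hv) ℓ 0) ↔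
      p ∈ I ⊔ Ideal.span {monomial (ℓ w) (1 : κ)} := by
  have hincl : ∀ q, inclusionMap κ N (le_addEdge (w := w) hv) 0
      (Finsupp.single (emptyFace Δ) q) = Finsupp.single (emptyFace _) q := fun q =>
    inclusionMap_single _ _ _ _
  constructor
  · rintro ⟨a, ha⟩
    obtain ⟨b, s, rfl⟩ := exists_inclusionMap_add_vertex hv hw a
    obtain ⟨q, hq⟩ : ∃ q, homogenizedDiff κ Δ ℓ 0 b = Finsupp.single (emptyFace Δ) q :=
      ⟨_, Finsupp.unique_single _⟩
    rw [map_add, homogenizedDiff_inclusionMap, homogenizedDiff_vertexFace, hq, hincl,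
      ← Finsupp.single_add] at ha
    rw [← Finsupp.single_injective _ ha]
    exact Submodule.add_mem_sup ((hI q).1 ⟨b, hq⟩)
      (Ideal.mul_mem_left _ _ (Ideal.mem_span_singleton_self _))
  · intro hp
    obtain ⟨q, hq, r, hr, rfl⟩ := Submodule.mem_sup.1 hp
    obtain ⟨s, rfl⟩ := Ideal.mem_span_singleton'.1 hr
    obtain ⟨b, hb⟩ := (hI q).2 hq
    refine ⟨inclusionMap κ N (le_addEdge hv) 1 b +
      Finsupp.single (vertexFace w (singleton_mem_addEdge hv)) s, ?_⟩
    rw [map_add, homogenizedDiff_inclusionMap, homogenizedDiff_vertexFace, hb, hincl,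
      ← Finsupp.single_add]

/-- If the complex with the edge added is exact in degree `1`, then the colon ideal is principal. -/
theorem monomial_dvd_of_exact_addEdge {I : Ideal (MvPolynomial (Fin N) κ)} (hv : {v} ∈ Δ)
    (hw : {w} ∉ Δ)
    (hI : ∀ p, Finsupp.single (emptyFace Δ) p ∈ LinearMap.range (homogenizedDiff κ Δ ℓ 0) ↔
      p ∈ I)
    (hex : Function.Exact (homogenizedDiff κ (addEdge Δ v w hv) ℓ 1)
      (homogenizedDiff κ (addEdge Δ v w hv) ℓ 0))
    (s : MvPolynomial (Fin N) κ) (hs : s * monomial (ℓ w) 1 ∈ I) :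
    monomial (ℓ v ⊔ ℓ w - ℓ w) 1 ∣ s := by
  have hne := ne_of_singleton_notMem hv hw
  obtain ⟨b, hb⟩ := (hI _).2 hs
  -- The relation `s * m ∈ I` becomes a 1-cycle of the enlarged complex with coefficient `-s` at the
  -- new vertex. Only the new edge has a boundary involving that vertex, so a bounding chain forces
  -- the divisibility.
  have hz : homogenizedDiff κ (addEdge Δ v w hv) ℓ 0 (inclusionMap κ N (le_addEdge hv) 1 b -
      Finsupp.single (vertexFace w (singleton_mem_addEdge hv)) s) = 0 := by
    rw [map_sub, homogenizedDiff_inclusionMap, homogenizedDiff_vertexFace, hb,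
      inclusionMap_single, sub_eq_zero]
    rfl
  obtain ⟨a, ha⟩ := (hex _).1 hz
  obtain ⟨c, t, rfl⟩ := exists_inclusionMap_add_edge hv hw a
  obtain ⟨ε, -, hε⟩ := homogenizedDiff_edgeFace (κ := κ) ℓ w v hne (pair_mem_addEdge hv)
    (singleton_mem_addEdge hv) (le_addEdge hv hv)
  rw [map_add, homogenizedDiff_inclusionMap, hε] at ha
  have hnot : ¬ ((vertexFace w (singleton_mem_addEdge (w := w) hv)).1 = ∅ ∨
      (vertexFace w (singleton_mem_addEdge (w := w) hv)).1 ∈ Δ) := by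
    rintro (h | h)
    · exact Finset.singleton_ne_empty w h
    · exact hw h
  have hvw : vertexFace w (singleton_mem_addEdge hv) ≠ vertexFace v (le_addEdge (w := w) hv hv) :=
    fun h => hne (Finset.singleton_injective (congrArg Subtype.val h))
  have hcoe := DFunLike.congr_fun ha (vertexFace w (singleton_mem_addEdge hv))
  simp only [Finsupp.add_apply, Finsupp.sub_apply, inclusionMap_apply_of_notMem _ _ _ _ hnot,
    Finsupp.single_eq_same, Finsupp.single_eq_of_ne hvw, zero_add, sub_zero, zero_sub] at hcoe
  rw [← dvd_neg, ← hcoe]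
  exact Dvd.intro_left _ (mul_assoc _ _ _)

/-- Exactness of the complex with the edge added, when the colon ideal is principal. -/
theorem exact_addEdge {I : Ideal (MvPolynomial (Fin N) κ)} (hv : {v} ∈ Δ)
    (hw : {w} ∉ Δ)
    (hI : ∀ p, Finsupp.single (emptyFace Δ) p ∈ LinearMap.range (homogenizedDiff κ Δ ℓ 0) ↔
      p ∈ I)
    (hex : ∀ i, Function.Exact (homogenizedDiff κ Δ ℓ (i + 1)) (homogenizedDiff κ Δ ℓ i))
    (hdvd : ∀ s : MvPolynomial (Fin N) κ, s * monomial (ℓ w) 1 ∈ I →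
      monomial (ℓ v ⊔ ℓ w - ℓ w) 1 ∣ s) (i : ℕ) :
    Function.Exact (homogenizedDiff κ (addEdge Δ v w hv) ℓ (i + 1))
      (homogenizedDiff κ (addEdge Δ v w hv) ℓ i) := by
  have hne := ne_of_singleton_notMem hv hw
  have hvΓ : {v} ∈ addEdge Δ v w hv := le_addEdge hv hv
  have hdd : ∀ j b, homogenizedDiff κ (addEdge Δ v w hv) ℓ j
      (homogenizedDiff κ (addEdge Δ v w hv) ℓ (j + 1)
        (inclusionMap κ N (le_addEdge hv) (j + 2) b)) = 0 := by
    intro j b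
    rw [homogenizedDiff_inclusionMap, homogenizedDiff_inclusionMap,
      (hex j).apply_apply_eq_zero, map_zero]
  have hlift : ∀ j b, homogenizedDiff κ (addEdge Δ v w hv) ℓ j
      (inclusionMap κ N (le_addEdge hv) (j + 1) b) = 0 →
      ∃ c, homogenizedDiff κ (addEdge Δ v w hv) ℓ (j + 1)
        (inclusionMap κ N (le_addEdge hv) (j + 2) c) =
          inclusionMap κ N (le_addEdge hv) (j + 1) b := by
    intro j b hb
    rw [homogenizedDiff_inclusionMap, ← map_zero (inclusionMap κ N (le_addEdge hv) j)] at hb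
    obtain ⟨c, hc⟩ := (hex j b).1 (inclusionMap_injective _ _ hb)
    exact ⟨c, by rw [homogenizedDiff_inclusionMap, hc]⟩
  obtain ⟨ε, hε2, hε⟩ := homogenizedDiff_edgeFace (κ := κ) ℓ w v hne (pair_mem_addEdge hv)
    (singleton_mem_addEdge hv) hvΓ
  have hCC : ∀ q : MvPolynomial (Fin N) κ, C ε * (C ε * q) = q := fun q => by
    rw [← mul_assoc, ← C_mul, ← pow_two, hε2, C_1, one_mul]
  have hmon : ∀ (c : Fin N →₀ ℕ) (_ : c ≤ ℓ v ⊔ ℓ w) (q : MvPolynomial (Fin N) κ),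
      q * monomial (ℓ v ⊔ ℓ w - c) 1 * monomial c 1 = q * monomial (ℓ v ⊔ ℓ w) 1 := by
    intro c hc q
    rw [mul_assoc, monomial_mul, mul_one, tsub_add_cancel_of_le hc]
  match i with
  | 0 =>
    intro a
    constructor
    · intro ha
      obtain ⟨b, s, rfl⟩ := exists_inclusionMap_add_vertex hv hw a
      rw [map_add, homogenizedDiff_inclusionMap, homogenizedDiff_vertexFace] at ha
      have hs : s * monomial (ℓ w) 1 ∈ I := by
        rw [← hI]
        refine ⟨-b, inclusionMap_injective (le_addEdge (w := w) hv) 0 ?_⟩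
        rw [map_neg, map_neg, neg_eq_of_add_eq_zero_right ha, inclusionMap_single]
        rfl
      obtain ⟨t, rfl⟩ := hdvd s hs
      -- As `ε ^ 2 = 1`, the factor `C ε` makes the boundary of `e` agree with the given cycle at
      -- the new vertex. Subtracting it leaves a cycle of `Δ`, which bounds there.
      set e := Finsupp.single (edgeFace w v hne (pair_mem_addEdge hv)) (C ε * t) with he
      have hde : homogenizedDiff κ (addEdge Δ v w hv) ℓ 0
          (homogenizedDiff κ (addEdge Δ v w hv) ℓ 1 e) = 0 := by
        rw [he, hε, map_sub, homogenizedDiff_vertexFace, homogenizedDiff_vertexFace]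
        simp only [mul_assoc, hCC]
        rw [← mul_assoc, ← mul_assoc, hmon _ le_sup_right, hmon _ le_sup_left, sub_self]
      have hde' : ∃ q, homogenizedDiff κ (addEdge Δ v w hv) ℓ 1 e =
          Finsupp.single (vertexFace w (singleton_mem_addEdge hv))
            (monomial (ℓ v ⊔ ℓ w - ℓ w) 1 * t) -
          inclusionMap κ N (le_addEdge hv) 1 (Finsupp.single (vertexFace v hv) q) := by
        refine ⟨t * monomial (ℓ v ⊔ ℓ w - ℓ v) 1, ?_⟩
        rw [he, hε, inclusionMap_single]
        simp only [mul_assoc, hCC]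
        rw [mul_comm t]
        rfl
      obtain ⟨q, hq⟩ := hde'
      have hb : homogenizedDiff κ (addEdge Δ v w hv) ℓ 0
          (inclusionMap κ N (le_addEdge hv) 1 (b + Finsupp.single (vertexFace v hv) q)) = 0 := by
        rw [← homogenizedDiff_inclusionMap, ← homogenizedDiff_vertexFace (Δ := addEdge Δ v w hv)
          ℓ w (singleton_mem_addEdge hv), ← map_add] at ha
        have hsub : inclusionMap κ N (le_addEdge hv) 1 (b + Finsupp.single (vertexFace v hv) q) =
            inclusionMap κ N (le_addEdge hv) 1 b +
              Finsupp.single (vertexFace w (singleton_mem_addEdge hv))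
                (monomial (ℓ v ⊔ ℓ w - ℓ w) 1 * t) -
              homogenizedDiff κ (addEdge Δ v w hv) ℓ 1 e := by
          rw [hq, map_add]
          abel
        rw [hsub, map_sub, ha, hde, sub_zero]
      obtain ⟨c, hc⟩ := hlift 0 _ hb
      refine ⟨inclusionMap κ N (le_addEdge hv) 2 c + e, ?_⟩
      rw [map_add, hc, hq, map_add]
      abel
    · rintro ⟨b, rfl⟩
      obtain ⟨b, s, rfl⟩ := exists_inclusionMap_add_edge hv hw b
      rw [map_add, map_add, hdd, zero_add, hε, map_sub, homogenizedDiff_vertexFace,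
        homogenizedDiff_vertexFace, mul_assoc (C ε), mul_assoc (C ε), hmon _ le_sup_right,
        hmon _ le_sup_left, sub_self]
  | 1 =>
    intro a
    constructor
    · intro ha
      obtain ⟨b, s, rfl⟩ := exists_inclusionMap_add_edge hv hw a
      have hnot : ¬ ((vertexFace w (singleton_mem_addEdge (w := w) hv)).1 = ∅ ∨
          (vertexFace w (singleton_mem_addEdge (w := w) hv)).1 ∈ Δ) := by
        rintro (h | h)
        · exact Finset.singleton_ne_empty w h
        · exact hw h
      have hvw : vertexFace w (singleton_mem_addEdge hv) ≠ vertexFace v hvΓ :=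
        fun h => hne (Finset.singleton_injective (congrArg Subtype.val h))
      have hcoe := DFunLike.congr_fun ha (vertexFace w (singleton_mem_addEdge hv))
      rw [map_add, homogenizedDiff_inclusionMap, hε] at hcoe
      simp only [Finsupp.add_apply, Finsupp.sub_apply, Finsupp.zero_apply,
        inclusionMap_apply_of_notMem _ _ _ _ hnot,
        Finsupp.single_eq_same, Finsupp.single_eq_of_ne hvw, zero_add, sub_zero] at hcoe
      -- A 2-cycle cannot involve the new edge: its coefficient at `w` is a nonzero monomial times
      -- `± s`, and `S` is a domain.
      have hs : s = 0 := by
        have h0 := hCC (s * monomial (ℓ v ⊔ ℓ w - ℓ w) 1)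
        rw [hcoe, mul_zero] at h0
        refine (mul_eq_zero.1 h0.symm).resolve_right ?_
        simp [monomial_eq_zero]
      subst hs
      rw [Finsupp.single_zero, add_zero] at ha ⊢
      obtain ⟨c, hc⟩ := hlift 1 _ ha
      exact ⟨_, hc⟩
    · rintro ⟨b, rfl⟩
      obtain ⟨b, rfl⟩ := inclusionMap_addEdge_surjective κ N hv (le_refl 3) b
      exact hdd 1 b
  | i + 2 =>
    intro a
    constructor
    · intro ha
      obtain ⟨b, rfl⟩ := inclusionMap_addEdge_surjective κ N hv (by omega) a
      obtain ⟨c, hc⟩ := hlift _ _ ha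
      exact ⟨_, hc⟩
    · rintro ⟨b, rfl⟩
      obtain ⟨b, rfl⟩ := inclusionMap_addEdge_surjective κ N hv (by omega) b
      exact hdd _ b

theorem supportsFreeResolution_addEdge_iff [Finite V] {I : Ideal (MvPolynomial (Fin N) κ)}
    (hI : IsMonomialIdeal I) (hΔ : SupportsFreeResolution Δ ℓ I)
    (hn : ℓ v ∈ minGens I) (hm : ℓ w ∉ monomialsIn I) (hm0 : ℓ w ≠ 0)
    (hv : {v} ∈ Δ) (hw : {w} ∉ Δ) :
    SupportsFreeResolution (addEdge Δ v w hv) ℓ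
      (I ⊔ Ideal.span {monomial (ℓ w) (1 : κ)}) ↔ ℓ w ∈ CIdeal I (ℓ v) := by
  have hcok := (nonempty_coker_equiv_iff ℓ I).1 hΔ.coker
  rw [mem_CIdeal_iff_colon hI hn.1 hm hm0]
  constructor
  · intro hΓ
    exact monomial_dvd_of_exact_addEdge ℓ hv hw hcok (hΓ.exact 0)
  · intro h
    obtain ⟨p, hp⟩ := hΔ.bounded
    exact
      { free := fun i => inferInstance
        finite := fun i => inferInstance
        -- The new faces have at most two vertices, so from degree 3 on the two complexes have the
        -- same modules.
        bounded := ⟨max p 3, fun i hi =>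
          have := hp i ((le_max_left _ _).trans_lt hi)
          (inclusionMap_addEdge_surjective κ N hv
            ((le_max_right p 3).trans hi.le)).subsingleton⟩
        exact := exact_addEdge ℓ hv hw hcok hΔ.exact h
        coker := (nonempty_coker_equiv_iff ℓ _).2 (coker_addEdge ℓ hv hw hcok) }

theorem range_homogenizedDiff_addEdge_le_iff (hv : {v} ∈ Δ) (hw : {w} ∉ Δ) (hm0 : ℓ w ≠ 0)
    (hvw : ¬ ℓ v ≤ ℓ w) (hwv : ¬ ℓ w ≤ ℓ v) :
    (∀ i, LinearMap.range (homogenizedDiff κ Δ ℓ i) ≤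
      Ideal.span (Set.range (X : Fin N → MvPolynomial (Fin N) κ)) • ⊤) ↔
    ∀ i, LinearMap.range (homogenizedDiff κ (addEdge Δ v w hv) ℓ i) ≤
      Ideal.span (Set.range (X : Fin N → MvPolynomial (Fin N) κ)) • ⊤ := by
  constructor
  · intro h i
    have hincl : ∀ b, homogenizedDiff κ (addEdge Δ v w hv) ℓ i
        (inclusionMap κ N (le_addEdge hv) (i + 1) b) ∈
          Ideal.span (Set.range (X : Fin N → MvPolynomial (Fin N) κ)) •
            (⊤ : Submodule (MvPolynomial (Fin N) κ) _) := by
      intro b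
      rw [homogenizedDiff_inclusionMap]
      exact LinearMap.map_mem_smul_top _ (h i ⟨b, rfl⟩)
    rintro _ ⟨a, rfl⟩
    match i with
    | 0 =>
      obtain ⟨b, s, rfl⟩ := exists_inclusionMap_add_vertex hv hw a
      rw [map_add, homogenizedDiff_vertexFace]
      exact Submodule.add_mem _ (hincl b) (Finsupp.single_mem_smul_top _
        (Ideal.mul_mem_left _ _ (monomial_mem_span_X hm0 1)))
    | 1 =>
      obtain ⟨b, s, rfl⟩ := exists_inclusionMap_add_edge hv hw a
      obtain ⟨ε, -, hε⟩ := homogenizedDiff_edgeFace (κ := κ) ℓ w v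
        (ne_of_singleton_notMem hv hw) (pair_mem_addEdge hv)
        (singleton_mem_addEdge hv) (le_addEdge hv hv)
      rw [map_add, hε]
      -- With `c` the label of either endpoint, the entry is a unit only if one label divides the
      -- other, which `hvw` and `hwv` exclude.
      have hmem : ∀ c : Fin N →₀ ℕ, ¬ ℓ v ⊔ ℓ w ≤ c →
          C ε * (s * monomial (ℓ v ⊔ ℓ w - c) 1) ∈
            Ideal.span (Set.range (X : Fin N → MvPolynomial (Fin N) κ)) := fun c hc =>
        Ideal.mul_mem_left _ _ (Ideal.mul_mem_left _ _
          (monomial_mem_span_X (fun h0 => hc (tsub_eq_zero_iff_le.1 h0)) 1))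
      exact Submodule.add_mem _ (hincl b) (Submodule.sub_mem _
        (Finsupp.single_mem_smul_top _ (hmem _ fun hle => hvw (le_sup_left.trans hle)))
        (Finsupp.single_mem_smul_top _ (hmem _ fun hle => hwv (le_sup_right.trans hle))))
    | i + 2 =>
      obtain ⟨b, rfl⟩ := inclusionMap_addEdge_surjective κ N hv (by omega) a
      exact hincl b
  · rintro h i _ ⟨a, rfl⟩
    obtain ⟨r, hr⟩ := exists_leftInverse_inclusionMap (κ := κ) (N := N) (le_addEdge (w := w) hv) i
    rw [← hr (homogenizedDiff κ Δ ℓ i a), ← homogenizedDiff_inclusionMap]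
    exact LinearMap.map_mem_smul_top r (h i ⟨_, rfl⟩)

end AddEdge

end

theorem theorem4p12 {κ : Type*} [Field κ] {N : ℕ}
    (I : Ideal (MvPolynomial (Fin N) κ)) (hI : IsMonomialIdeal I)
    {V : Type*} [LinearOrder V] [Finite V]
    (Δ : PreAbstractSimplicialComplex V) (ℓ : V → Fin N →₀ ℕ)
    (hΔ : SupportsFreeResolution Δ ℓ I)
    (n m : Fin N →₀ ℕ) (hn : n ∈ minGens I)
    (hm : MvPolynomial.monomial m (1 : κ) ∉ I) (hmn : ¬ m ≤ n)
    (v w : V) (hv : {v} ∈ Δ) (hℓv : ℓ v = n) (hw : {w} ∉ Δ) (hℓw : ℓ w = m) :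
    (SupportsFreeResolution (addEdge Δ v w hv) ℓ
        (I ⊔ Ideal.span {MvPolynomial.monomial m (1 : κ)}) ↔ m ∈ CIdeal I n) ∧
    (m ∈ CIdeal I n →
      (SupportsMinimalFreeResolution Δ ℓ I ↔
        SupportsMinimalFreeResolution (addEdge Δ v w hv) ℓ
          (I ⊔ Ideal.span {MvPolynomial.monomial m (1 : κ)}))) := by
  subst hℓv hℓw
  have hm0 : ℓ w ≠ 0 := fun h => hmn (h ▸ zero_le)
  have hiff := supportsFreeResolution_addEdge_iff ℓ hI hΔ hn hm hm0 hv hw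
  refine ⟨hiff, fun hC => ?_⟩
  have hnm : ¬ ℓ v ≤ ℓ w := by
    obtain ⟨-, -, i, -, hi⟩ := hC
    exact fun hle => absurd (hle i) (not_le.2 hi)
  unfold SupportsMinimalFreeResolution
  rw [range_homogenizedDiff_addEdge_le_iff ℓ hv hw hm0 hnm hmn]
  exact and_congr_left fun _ => ⟨fun _ => hiff.2 hC, fun _ => hΔ⟩
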